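/- Let $\mathbf K$ be a field of characteristic zero and $n\ge 0$. Let $I=\{-n,\dots,-1,0,1,\dots,n\}$ for $g=so(2n+1)$ and $I=\{-n,\dots,-1,1,\dots,n\}$ for $g=so(2n)$ and $g=sp(n)$; put $\epsilon_i=1$ for all $i\in I$ in the orthogonal cases and $\epsilon_i=\operatorname{sgn} i$ for $g=sp(n)$. Realize $g$ as the Lie algebra of all matrices $(Y_{i,j})_{i,j\in I}$ over $\mathbf K$ with $Y_{i,j}=-\epsilon_i\epsilon_jY_{-j,-i}$. It is spanned by $X_{i,j}=E_{i,j}-\epsilon_i\epsilon_jE_{-j,-i}$ ($i,j\in I$, $E_{i,j}$ the matrix units), which satisfy $X_{i,j}=-\epsilon_i\epsilon_jX_{-j,-i}$ and $$[X_{i,j},X_{k,l}]=\delta_{k,j}X_{i,l}-\delta_{i,l}X_{k,j}+\epsilon_i\epsilon_j(\delta_{j,-l}X_{k,-i}-\delta_{k,-i}X_{-j,l}).$$ In the universal enveloping algebra $U(g)$ put, for $M\ge 1$, $(X^M)_{i,j}=\sum_{i_1,\dots,i_{M-1}\in I}X_{i,i_1}X_{i_1,i_2}\cdots X_{i_{M-1},j}$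 and $(X^M)=\sum_{i\in I}(X^M)_{i,i}$, and for $A\in\mathrm{Mat}(I,\mathbf K)$ put $(AX^M)=\sum_{i,j\in I}A_{j,i}(X^M)_{i,j}$. Let $F_A\subset U(g)$ be the (unital associative) subalgebra generated by all $(X^N)$ and $(AX^M)$, $N,M\ge 1$, and let $g_A\subset g$ be the linear span of the elements $(BX)=\sum_{i,j\in I}B_{j,i}X_{i,j}$, where $B$ runs over the matrices in $\mathrm{Mat}(I,\mathbf K)$ with $[B,A]=0$. Theorem 2. Suppose that, for one choice of the sign, $A_{i,j}=\pm\epsilon_i\epsilon_jA_{-j,-i}$ for all $i,j\in I$. Then (i) $F_A$ is commutative; (ii) $g_A$ coincides with the centralizer $\{Y\in g : [Y,f]=0 \text{ in } U(g) \text{ for all } f\in F_A\}$ of $F_A$ in $g$, except that in the case $g=so(2)$ this is asserted only for the sign $-$. -/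

import Mathlib

attribute [local instance] LieRing.ofAssociativeRing

/-- The three families of split classical Lie algebras under consideration:
`so(2n+1)`, `so(2n)` and `sp(n)` (the symplectic algebra of `2n × 2n` matrices). -/
inductive ClassicalFamily : Type
  | soOdd
  | soEven
  | sp

namespace ClassicalFamily

/-- The index set `I`: it is `{-n, …, -1, 0, 1, …, n}` for `so(2n+1)` and
`{-n, …, -1, 1, …, n}` for `so(2n)` and `sp(n)`. -/
noncomputable def indexSet : ClassicalFamily → ℕ → Finset ℤ
  | soOdd, n => Finset.Icc (-(n : ℤ)) n
  | soEven, n => (Finset.Icc (-(n : ℤ)) n).erase 0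
  | sp, n => (Finset.Icc (-(n : ℤ)) n).erase 0

/-- The index set `I` as a type. -/
abbrev Index (c : ClassicalFamily) (n : ℕ) : Type := {i : ℤ // i ∈ c.indexSet n}

theorem neg_mem_indexSet {c : ClassicalFamily} {n : ℕ} {i : ℤ} (hi : i ∈ c.indexSet n) :
    -i ∈ c.indexSet n := by
  cases c <;> simp [indexSet] at hi ⊢ <;> omega

/-- The involution `i ↦ -i` of the index set. -/
instance (c : ClassicalFamily) (n : ℕ) : Neg (Index c n) :=
  ⟨fun i => ⟨-i.1, neg_mem_indexSet i.2⟩⟩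

theorem coe_neg_index {c : ClassicalFamily} {n : ℕ} (i : Index c n) :
    ((-i : Index c n) : ℤ) = -(i : ℤ) := rfl

theorem neg_neg_index {c : ClassicalFamily} {n : ℕ} (i : Index c n) : - -i = i :=
  Subtype.ext (neg_neg i.1)

/-- The signs `ε_i`: equal to `1` for the orthogonal algebras, to `sgn i` for `sp(n)`. -/
noncomputable def eps : (c : ClassicalFamily) → {n : ℕ} → Index c n → ℤ
  | soOdd, _, _ => 1
  | soEven, _, _ => 1
  | sp, _, i => Int.sign i.1

theorem eps_mul_self {c : ClassicalFamily} {n : ℕ} (i : Index c n) : eps c i * eps c i = 1 := by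
  cases c
  · rfl
  · rfl
  · have h : (i : ℤ) ≠ 0 := by
      have := i.2
      simp only [indexSet, Finset.mem_erase] at this
      exact this.1
    rcases lt_or_gt_of_ne h with h | h
    · simp [eps, Int.sign_eq_neg_one_of_neg h]
    · simp [eps, Int.sign_eq_one_of_pos h]

/-- `ε_{-i} ε_{-j} = ε_i ε_j`. -/
theorem eps_neg_mul_eps_neg {c : ClassicalFamily} {n : ℕ} (i j : Index c n) :
    eps c (-i) * eps c (-j) = eps c i * eps c j := by
  cases c <;> simp [eps, coe_neg_index]

/-- The Lie algebra `g`, i.e. `so(2n+1)`, `so(2n)` or `sp(n)`, realized inside `gl` as the Lie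
subalgebra of all matrices `Y` with `Y_{i,j} = - ε_i ε_j Y_{-j,-i}`. -/
noncomputable def liealg (K : Type*) [Field K] (c : ClassicalFamily) (n : ℕ) :
    LieSubalgebra K (Matrix (Index c n) (Index c n) K) where
  carrier := {Y | ∀ i j, Y i j = -((eps c i * eps c j : ℤ) : K) * Y (-j) (-i)}
  zero_mem' := fun i j => by simp
  add_mem' := fun {Y Z} hY hZ i j => by
    simp only [Matrix.add_apply]
    rw [hY i j, hZ i j, mul_add]
  smul_mem' := fun a Y hY i j => by
    simp only [Matrix.smul_apply, smul_eq_mul]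
    rw [hY i j]
    ring
  lie_mem' := fun {Y Z} hY hZ i j => by
    have key : ∀ {P Q : Matrix (Index c n) (Index c n) K},
        (∀ i j, P i j = -((eps c i * eps c j : ℤ) : K) * P (-j) (-i)) →
        (∀ i j, Q i j = -((eps c i * eps c j : ℤ) : K) * Q (-j) (-i)) →
        (P * Q) i j = ((eps c i * eps c j : ℤ) : K) * (Q * P) (-j) (-i) := by
      intro P Q hP hQ
      rw [Matrix.mul_apply, Matrix.mul_apply, Finset.mul_sum]
      refine Fintype.sum_equiv (Function.Involutive.toPerm _ neg_neg_index) _ _ fun k => ?_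
      rw [hP i k, hQ k j]
      have h : ((eps c k : ℤ) : K) * ((eps c k : ℤ) : K) = 1 := by
        exact_mod_cast congrArg (Int.cast : ℤ → K) (eps_mul_self k)
      change _ = ((eps c i * eps c j : ℤ) : K) * (Q (-j) (-k) * P (-k) (-i))
      push_cast
      linear_combination
        ((eps c i : ℤ) : K) * ((eps c j : ℤ) : K) * P (-k) (-i) * Q (-j) (-k) * h
    rw [Ring.lie_def, Matrix.sub_apply, Matrix.sub_apply, key hY hZ, key hZ hY]
    ring

/-- The matrix `E_{i,j} - ε_i ε_j E_{-j,-i}`. -/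
noncomputable def genCarrier (K : Type*) [Field K] {c : ClassicalFamily} {n : ℕ} (i j : Index c n) :
    Matrix (Index c n) (Index c n) K :=
  Matrix.single i j 1 - ((eps c i * eps c j : ℤ) : K) • Matrix.single (-j) (-i) 1

theorem genCarrier_mem (K : Type*) [Field K] {c : ClassicalFamily} {n : ℕ} (i j : Index c n) :
    genCarrier K i j ∈ liealg K c n := by
  intro k l
  have e2 : ∀ a b : Index c n, (-a = -b) ↔ (a = b) := fun a b =>
    (Function.Involutive.injective neg_neg_index).eq_iff
  have e1 : ∀ a b : Index c n, (-a = b) ↔ (a = -b) := fun a b => by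
    rw [← e2, neg_neg_index]
  have P : (if i = k ∧ j = l then (1 : K) else 0) =
      ((eps c k * eps c l : ℤ) : K) * ((eps c i * eps c j : ℤ) : K) *
        (if i = k ∧ j = l then (1 : K) else 0) := by
    split_ifs with h
    · obtain ⟨rfl, rfl⟩ := h
      rw [← Int.cast_mul, mul_mul_mul_comm, eps_mul_self, eps_mul_self]
      simp
    · simp
  have Q : ((eps c i * eps c j : ℤ) : K) * (if i = -l ∧ j = -k then (1 : K) else 0) =
      ((eps c k * eps c l : ℤ) : K) * (if i = -l ∧ j = -k then (1 : K) else 0) := by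
    split_ifs with h
    · obtain ⟨rfl, rfl⟩ := h
      rw [eps_neg_mul_eps_neg, mul_comm (eps c l)]
    · simp
  simp only [genCarrier, Matrix.sub_apply, Matrix.smul_apply, Matrix.single_apply, smul_eq_mul, e1,
    neg_neg_index]
  simp only [and_comm (a := j = -k), and_comm (a := j = l)]
  linear_combination P - Q

/-- The elements `X_{i,j} = E_{i,j} - ε_i ε_j E_{-j,-i}` of `g`. -/
noncomputable def gen (K : Type*) [Field K] {c : ClassicalFamily} {n : ℕ} (i j : Index c n) : liealg K c n :=
  ⟨genCarrier K i j, genCarrier_mem K i j⟩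

/-- `X_{i,j} = - ε_i ε_j X_{-j,-i}`. -/
theorem gen_symm (K : Type*) [Field K] {c : ClassicalFamily} {n : ℕ} (i j : Index c n) :
    gen K i j = -((eps c i * eps c j : ℤ) : K) • gen K (-j) (-i) := by
  have h : ((eps c i * eps c j : ℤ) : K) * ((eps c i * eps c j : ℤ) : K) = 1 := by
    rw [← Int.cast_mul, mul_mul_mul_comm, eps_mul_self, eps_mul_self]
    simp
  apply Subtype.ext
  change genCarrier K i j = -((eps c i * eps c j : ℤ) : K) • genCarrier K (-j) (-i)
  simp only [genCarrier, neg_neg_index, eps_neg_mul_eps_neg, mul_comm (eps c (-j))]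
  rw [smul_sub, smul_smul, neg_mul, h]
  simp only [neg_smul, one_smul]
  abel

/-- The elements `X_{i,j}` satisfy the usual commutation relations. -/
theorem lie_gen_gen (K : Type*) [Field K] {c : ClassicalFamily} {n : ℕ} (i j k l : Index c n) :
    ⁅gen K i j, gen K k l⁆ =
      (if k = j then gen K i l else 0) - (if i = l then gen K k j else 0)
        + ((eps c i * eps c j : ℤ) : K) •
          ((if j = -l then gen K k (-i) else 0) - (if k = -i then gen K (-j) l else 0)) := by
  have hE : ∀ a b d e : Index c n,
      (Matrix.single a b 1 * Matrix.single d e 1 : Matrix (Index c n) (Index c n) K) =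
        if b = d then Matrix.single a e 1 else 0 := by
    intro a b d e
    split_ifs with h
    · subst h
      simp
    · exact Matrix.single_mul_single_of_ne _ _ _ _ h _
  have hsq : ∀ a : Index c n, ((eps c a : ℤ) : K) * ((eps c a : ℤ) : K) = 1 := fun a => by
    rw [← Int.cast_mul, eps_mul_self, Int.cast_one]
  have hng : ∀ a b : Index c n, ((eps c (-a) : ℤ) : K) * ((eps c (-b) : ℤ) : K) =
      ((eps c a : ℤ) : K) * ((eps c b : ℤ) : K) := fun a b => by
    rw [← Int.cast_mul, ← Int.cast_mul, eps_neg_mul_eps_neg]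
  have hng' : ∀ a b : Index c n, ((eps c a : ℤ) : K) * ((eps c (-a) : ℤ) : K) =
      ((eps c b : ℤ) : K) * ((eps c (-b) : ℤ) : K) := fun a b => by
    linear_combination ((eps c a : ℤ) : K) * ((eps c (-b) : ℤ) : K) * (hng a b) -
      ((eps c a : ℤ) : K) * ((eps c (-a) : ℤ) : K) * (hsq (-b)) +
      ((eps c b : ℤ) : K) * ((eps c (-b) : ℤ) : K) * (hsq a)
  have e2 : ∀ a b : Index c n, (-a = -b) ↔ (a = b) := fun a b =>
    (Function.Involutive.injective neg_neg_index).eq_iff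
  have e1 : ∀ a b : Index c n, (-a = b) ↔ (a = -b) := fun a b => by
    rw [← e2, neg_neg_index]
  have hite : ∀ (p : Prop) [Decidable p] (a b : Index c n),
      (((if p then gen K a b else 0 : liealg K c n)) : Matrix (Index c n) (Index c n) K) =
        if p then genCarrier K a b else 0 := by
    intro p _ a b
    split_ifs <;> rfl
  apply Subtype.ext
  change ⁅genCarrier K i j, genCarrier K k l⁆ =
    ((if k = j then gen K i l else 0 : liealg K c n) : Matrix (Index c n) (Index c n) K) -
      ((if i = l then gen K k j else 0 : liealg K c n) : Matrix (Index c n) (Index c n) K) +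
      ((eps c i * eps c j : ℤ) : K) •
        (((if j = -l then gen K k (-i) else 0 : liealg K c n) : Matrix (Index c n) (Index c n) K) -
          ((if k = -i then gen K (-j) l else 0 : liealg K c n) : Matrix (Index c n) (Index c n) K))
  rw [hite, hite, hite, hite, Ring.lie_def]
  simp only [genCarrier, mul_sub, sub_mul, smul_mul_assoc, mul_smul_comm, hE, neg_neg_index,
    e2, e1, smul_sub, smul_smul]
  have n1 : (j = k) ↔ (k = j) := eq_comm
  have n2 : (l = i) ↔ (i = l) := eq_comm
  have n3 : (i = -k) ↔ (k = -i) := by rw [← e1, eq_comm]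
  have n4 : (l = -j) ↔ (j = -l) := by rw [← e1, eq_comm]
  rw [if_congr n1 rfl rfl, if_congr n2 rfl rfl, if_congr n3 rfl rfl, if_congr n4 rfl rfl]
  have T : ∀ (p : Prop) [Decidable p] (x y : K) (P Q : Matrix (Index c n) (Index c n) K),
      (p → x = y) →
      (if p then P - x • Q else 0) = (if p then P else 0) - y • (if p then Q else 0) := by
    intro p _ x y P Q h
    split_ifs with hp
    · rw [h hp]
    · simp
  rw [T (k = j) _ (((eps c i * eps c j : ℤ) : K) * ((eps c k * eps c l : ℤ) : K)),
    T (i = l) _ (((eps c k * eps c l : ℤ) : K) * ((eps c i * eps c j : ℤ) : K)),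
    T (j = -l) _ (((eps c i * eps c j : ℤ) : K) * ((eps c k * eps c l : ℤ) : K)),
    T (k = -i) _ (((eps c i * eps c j : ℤ) : K) * ((eps c k * eps c l : ℤ) : K))]
  · have h1 : ((eps c i * eps c j : ℤ) : K) * (((eps c i * eps c j : ℤ) : K) *
        ((eps c k * eps c l : ℤ) : K)) = ((eps c k * eps c l : ℤ) : K) := by
      push_cast
      linear_combination ((eps c k : ℤ) : K) * ((eps c l : ℤ) : K) * ((eps c j : ℤ) : K) *
        ((eps c j : ℤ) : K) * hsq i + ((eps c k : ℤ) : K) * ((eps c l : ℤ) : K) * hsq j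
    simp only [smul_sub, smul_smul, h1]
    abel
  · rintro rfl
    push_cast
    linear_combination (-((eps c (-j) : ℤ) : K) * ((eps c l : ℤ) : K)) * hsq j -
      ((eps c l : ℤ) : K) * ((eps c j : ℤ) : K) * hng' i j
  · rintro rfl
    push_cast
    linear_combination (-((eps c k : ℤ) : K) * ((eps c (-i) : ℤ) : K)) * hsq i -
      ((eps c k : ℤ) : K) * ((eps c i : ℤ) : K) * hng' l i
  · rintro rfl
    push_cast
    linear_combination (-((eps c k : ℤ) : K) * ((eps c j : ℤ) : K)) * hsq i
  · rintro rfl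
    push_cast
    linear_combination (-((eps c i : ℤ) : K) * ((eps c l : ℤ) : K)) * hsq k

/-- Every `Y` in `g` is `½ ∑ Y_{i,j} X_{i,j}`, so that the `X_{i,j}` span `g` when `2 ≠ 0`. -/
theorem two_smul_eq_sum_gen (K : Type*) [Field K] {c : ClassicalFamily} {n : ℕ}
    (Y : liealg K c n) :
    (2 : K) • Y = ∑ i, ∑ j, (Y : Matrix (Index c n) (Index c n) K) i j • gen K i j := by
  have hc : ((∑ i, ∑ j, (Y : Matrix (Index c n) (Index c n) K) i j • gen K i j : liealg K c n) :
      Matrix (Index c n) (Index c n) K) =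
      ∑ i, ∑ j, (Y : Matrix (Index c n) (Index c n) K) i j • genCarrier K i j := by
    rw [← LieSubalgebra.coe_incl', map_sum]
    simp only [map_sum, map_smul]
    rfl
  have e1 : ∀ a b : Index c n, (-a = b) ↔ (a = -b) := fun a b =>
    ⟨fun h => by rw [← h, neg_neg_index], fun h => by rw [h, neg_neg_index]⟩
  apply Subtype.ext
  rw [hc]
  ext k l
  have hY := Y.2 k l
  have hs : ∀ a b : Index c n, ∀ x : Matrix (Index c n) (Index c n) K,
      (∑ i, ∑ j, x i j * if i = a ∧ j = b then (1 : K) else 0) = x a b := by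
    intro a b x
    simp [ite_and]
  change (2 : K) * (Y : Matrix (Index c n) (Index c n) K) k l = _
  simp only [Matrix.sum_apply, Matrix.smul_apply, genCarrier, Matrix.sub_apply,
    Matrix.single_apply, smul_eq_mul, mul_sub, Finset.sum_sub_distrib, e1]
  rw [hs]
  have h2 := hs (-l) (-k)
    (fun i j => (Y : Matrix (Index c n) (Index c n) K) i j * ((eps c i * eps c j : ℤ) : K))
  rw [eps_neg_mul_eps_neg] at h2
  simp only [mul_assoc] at h2
  simp only [and_comm (a := (_ : Index c n) = -k)]
  rw [h2, mul_comm (eps c l)]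
  linear_combination hY

/-- The matrix `X = (X_{i,j})` with entries in the universal enveloping algebra `U(g)`. -/
noncomputable def genMatrix (K : Type*) [Field K] (c : ClassicalFamily) (n : ℕ) :
    Matrix (Index c n) (Index c n) (UniversalEnvelopingAlgebra K (liealg K c n)) :=
  Matrix.of fun i j => UniversalEnvelopingAlgebra.ι K (gen K i j)

/-- The element `(X^M) = ∑_i (X^M)_{i,i}` of `U(g)`, where
`(X^M)_{i,j} = ∑ X_{i,i₁} X_{i₁,i₂} ⋯ X_{i_{M-1},j}`. -/
noncomputable def tracePow (K : Type*) [Field K] (c : ClassicalFamily) (n M : ℕ) :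
    UniversalEnvelopingAlgebra K (liealg K c n) :=
  ∑ i, (genMatrix K c n ^ M) i i

/-- The element `(AX^M) = ∑_{i,j} A_{j,i} (X^M)_{i,j}` of `U(g)`. -/
noncomputable def shiftedPow {K : Type*} [Field K] {c : ClassicalFamily} {n : ℕ}
    (A : Matrix (Index c n) (Index c n) K) (M : ℕ) :
    UniversalEnvelopingAlgebra K (liealg K c n) :=
  ∑ i, ∑ j, A j i • (genMatrix K c n ^ M) i j

/-- The subalgebra `F_A` of `U(g)` generated by all `(X^N)` and `(AX^M)`, `N, M ≥ 1`. -/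
noncomputable def FA {K : Type*} [Field K] {c : ClassicalFamily} {n : ℕ}
    (A : Matrix (Index c n) (Index c n) K) :
    Subalgebra K (UniversalEnvelopingAlgebra K (liealg K c n)) :=
  Algebra.adjoin K
    ({u | ∃ N : ℕ, 1 ≤ N ∧ u = tracePow K c n N} ∪ {u | ∃ M : ℕ, 1 ≤ M ∧ u = shiftedPow A M})

/-- The element `(BX) = ∑_{i,j} B_{j,i} X_{i,j}` of `g`. -/
noncomputable def linearElt {K : Type*} [Field K] {c : ClassicalFamily} {n : ℕ}
    (B : Matrix (Index c n) (Index c n) K) : liealg K c n :=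
  ∑ i, ∑ j, B j i • gen K i j

/-- The subspace `g_A` of `g` spanned by the elements `(BX)`, where `B` runs over the matrices
with `[B, A] = 0`. -/
noncomputable def gA {K : Type*} [Field K] {c : ClassicalFamily} {n : ℕ}
    (A : Matrix (Index c n) (Index c n) K) : Submodule K (liealg K c n) :=
  Submodule.span K {Y | ∃ B : Matrix (Index c n) (Index c n) K, ⁅B, A⁆ = 0 ∧ Y = linearElt B}

/-- The centralizer in `g` of a subalgebra `F` of `U(g)`: all `Y` in `g` that commute in `U(g)`
with every element of `F`. -/
noncomputable def centralizer {K : Type*} [Field K] {c : ClassicalFamily} {n : ℕ}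
    (F : Subalgebra K (UniversalEnvelopingAlgebra K (liealg K c n))) :
    LieSubalgebra K (liealg K c n) where
  carrier := {Y | ∀ f ∈ F, ⁅UniversalEnvelopingAlgebra.ι K Y, f⁆ = 0}
  zero_mem' := fun f _ => by simp
  add_mem' := fun {Y Z} hY hZ f hf => by
    rw [map_add, add_lie, hY f hf, hZ f hf, add_zero]
  smul_mem' := fun a Y hY f hf => by
    rw [map_smul, smul_lie, hY f hf, smul_zero]
  lie_mem' := fun {Y Z} hY hZ f hf => by
    rw [LieHom.map_lie, lie_lie, hY f hf, hZ f hf, lie_zero, lie_zero, sub_zero]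

end ClassicalFamily

/-! Write `N` for the size of `I`, σ for `negSign c`, and `twist` for transposition with respect to
the invariant form, so that X is `twist`-antisymmetric and the hypothesis says that A is a
`twist`-eigenvector with eigenvalue `s = ±1`.

Commutativity. The entries of X^M transform under g like those of X, so (X^M) is central. The
commutator of (AX^M) and (AX^L) expands by the Leibniz rule into differences of pairings tr(A Y A Z)
with the two arguments exchanged, of total degree one less. Conversely, exchanging Y and Z in tr(A Y
A Z) costs commutators of elements (AY'), (AZ') and further exchanged pairings, again of total
degree one less. Hence commutativity of the (AY) and symmetry of the pairing are proved together, by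
induction on the total degree (`commute_trace_and_pairing_comm`). The expansions involve `twist` of
powers of X; these are combinations of powers of no larger degree with central coefficients
(`twist_pow_mem_centralSpan`), which closes the induction.

Centralizer. The commutator of Y with (AX^M) is (BX^M), where B = [A, Yᵀ]. So everything commuting
with A centralizes F_A. Conversely, if all (BX^M) vanish, the defining representation gives B = 0:
for `s = -1` from M = 1, for `s = 1` from M = 2, where Bᵀ appears with the factor N - 2σ. That
factor vanishes only for so(2) (`commute_of_mem_centralizer`). -/

namespace ClassicalFamily

open Matrix

open Finset.HasAntidiagonal (antidiagonal)

/-! ### Transposition with respect to the invariant form. -/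

section Twist

variable {c : ClassicalFamily} {n : ℕ} {R : Type*} [Ring R]

/-- The sign `ε_i ε_{-i}`, which does not depend on `i`. -/
def negSign : ClassicalFamily → ℤ
  | soOdd => 1
  | soEven => 1
  | sp => -1

theorem eps_neg (i : Index c n) : eps c (-i) = negSign c * eps c i := by
  cases c <;> simp [eps, negSign, coe_neg_index]

theorem negSign_mul_self (c : ClassicalFamily) : negSign c * negSign c = 1 := by
  cases c <;> simp [negSign]

theorem sum_neg_index {M : Type*} [AddCommMonoid M] (f : Index c n → M) :
    ∑ i, f (-i) = ∑ i, f i :=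
  Fintype.sum_equiv (Function.Involutive.toPerm _ neg_neg_index) _ _ fun _ => rfl

theorem neg_index_eq_iff (a b : Index c n) : -a = b ↔ a = -b :=
  ⟨fun h => by rw [← h, neg_neg_index], fun h => by rw [h, neg_neg_index]⟩

/-- The transposition of matrices with respect to the invariant bilinear form. -/
noncomputable def twist (Y : Matrix (Index c n) (Index c n) R) : Matrix (Index c n) (Index c n) R :=
  Matrix.of fun i j => (eps c i * eps c j) • Y (-j) (-i)

theorem twist_apply (Y : Matrix (Index c n) (Index c n) R) (i j : Index c n) :
    twist Y i j = (eps c i * eps c j) • Y (-j) (-i) := rfl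

theorem twist_add (Y Z : Matrix (Index c n) (Index c n) R) :
    twist (Y + Z) = twist Y + twist Z := by
  ext i j
  simp [twist_apply]

theorem twist_sub (Y Z : Matrix (Index c n) (Index c n) R) :
    twist (Y - Z) = twist Y - twist Z := by
  ext i j
  simp [twist_apply, smul_sub]

theorem twist_smul {S : Type*} [Monoid S] [DistribMulAction S R] (a : S)
    (Y : Matrix (Index c n) (Index c n) R) : twist (a • Y) = a • twist Y := by
  ext i j
  simp only [twist_apply, Matrix.smul_apply, smul_comm a]

theorem twist_one : twist (1 : Matrix (Index c n) (Index c n) R) = 1 := by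
  ext i j
  by_cases h : i = j
  · subst h
    simp [twist_apply, eps_mul_self]
  · have h' : -j ≠ -i := fun e => h ((neg_index_eq_iff _ _).1 e ▸ neg_neg_index i).symm
    simp [twist_apply, one_apply_ne h, one_apply_ne h']

theorem twist_single (i j : Index c n) (a : R) :
    twist (Matrix.single i j a) = (eps c i * eps c j) • Matrix.single (-j) (-i) a := by
  ext k l
  simp only [twist_apply, Matrix.smul_apply, Matrix.single_apply, neg_index_eq_iff j k,
    neg_index_eq_iff i l]
  by_cases h : i = -l ∧ j = -k
  · obtain ⟨rfl, rfl⟩ := h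
    simp only [and_self, if_true, eps_neg_mul_eps_neg, mul_comm (eps c l)]
  · rw [if_neg h, if_neg (fun h' => h (And.symm h')), smul_zero, smul_zero]

/-- Over a noncommutative ring, reversing a product also reverses the order of the entries; hence
the commutation hypothesis. For products of matrices over U(g) the correction terms are found in
`IsEquivariant.twist_genMatrix_mul`. -/
theorem twist_mul {F G : Matrix (Index c n) (Index c n) R}
    (h : ∀ i j k l, Commute (F i j) (G k l)) : twist (F * G) = twist G * twist F := by
  ext i j
  simp only [twist_apply, mul_apply, Finset.smul_sum]
  rw [← sum_neg_index]
  refine Finset.sum_congr rfl fun k _ => ?_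
  have e : eps c i * eps c k * (eps c k * eps c j) = eps c i * eps c j := by
    linear_combination eps c i * eps c j * eps_mul_self k
  rw [(h _ _ _ _).eq, smul_mul_smul_comm, e]

/-- No commutation of entries is needed here: both sides keep the factors in the order F, G and
differ only by reindexing. -/
theorem trace_mul_twist (F G : Matrix (Index c n) (Index c n) R) :
    trace (F * twist G) = trace (twist F * G) := by
  simp only [trace, diag_apply, mul_apply, twist_apply, mul_smul_comm, smul_mul_assoc]
  rw [← sum_neg_index, Finset.sum_comm, ← sum_neg_index]
  rw [Finset.sum_comm]
  rw [Finset.sum_comm]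
  refine Finset.sum_congr rfl fun i _ => Finset.sum_congr rfl fun j _ => ?_
  simp only [neg_neg_index, eps_neg_mul_eps_neg, mul_comm (eps c i)]

theorem trace_mul_comm_of_commute {ι R : Type*} [Fintype ι] [Ring R] {F G : Matrix ι ι R}
    (h : ∀ i j k l, Commute (F i j) (G k l)) : trace (F * G) = trace (G * F) := by
  simp only [trace, diag_apply, mul_apply]
  rw [Finset.sum_comm]
  exact Finset.sum_congr rfl fun i _ => Finset.sum_congr rfl fun j _ => h _ _ _ _

end Twist

/-! ### Scalar matrices of K inside matrices over an algebra. -/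

section Hat

variable {K : Type*} [Field K] {ι : Type*} [Fintype ι] [DecidableEq ι] {R : Type*} [Ring R]
  [Algebra K R]

/-- A matrix of scalars, viewed as a matrix over a `K`-algebra. -/
noncomputable abbrev hat (R : Type*) [Ring R] [Algebra K R] : Matrix ι ι K →ₐ[K] Matrix ι ι R :=
  (Algebra.ofId K R).mapMatrix

theorem hat_apply (B : Matrix ι ι K) (i j : ι) : hat R B i j = algebraMap K R (B i j) := rfl

theorem commute_hat (B : Matrix ι ι K) (W : Matrix ι ι R) (i j k l : ι) :
    Commute (hat R B i j) (W k l) := Algebra.commutes _ _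

theorem trace_hat_mul_comm (B : Matrix ι ι K) (W : Matrix ι ι R) :
    trace (hat R B * W) = trace (W * hat R B) :=
  trace_mul_comm_of_commute (commute_hat B W)

theorem hat_single_mul_apply (i j : ι) (W : Matrix ι ι R) (k l : ι) :
    (hat R (Matrix.single i j (1 : K)) * W) k l = if i = k then W j l else 0 := by
  simp only [mul_apply, hat_apply, Matrix.single_apply]
  rw [Finset.sum_eq_single j]
  · split_ifs <;> simp_all
  · intro b _ hb
    rw [if_neg (fun h => hb h.2.symm)]
    simp
  · simp

theorem mul_hat_single_apply (i j : ι) (W : Matrix ι ι R) (k l : ι) :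
    (W * hat R (Matrix.single i j (1 : K))) k l = if j = l then W k i else 0 := by
  simp only [mul_apply, hat_apply, Matrix.single_apply]
  rw [Finset.sum_eq_single i]
  · split_ifs <;> simp_all
  · intro b _ hb
    rw [if_neg (fun h => hb h.1.symm)]
    simp
  · simp

theorem trace_hat_single_mul (i j : ι) (W : Matrix ι ι R) :
    trace (hat R (Matrix.single i j (1 : K)) * W) = W j i := by
  simp only [trace, diag_apply, hat_single_mul_apply, Finset.sum_ite_eq, Finset.mem_univ, if_true]

end Hat

section HatTwist

variable {K : Type*} [Field K] {c : ClassicalFamily} {n : ℕ} {R : Type*} [Ring R]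
  [Algebra K R]

theorem twist_hat (B : Matrix (Index c n) (Index c n) K) : twist (hat R B) = hat R (twist B) := by
  ext i j
  simp only [twist_apply, hat_apply, map_zsmul]

theorem twist_hat_mul (B : Matrix (Index c n) (Index c n) K)
    (W : Matrix (Index c n) (Index c n) R) :
    twist (hat R B * W) = twist W * hat R (twist B) := by
  rw [twist_mul (commute_hat B W), twist_hat]

theorem twist_mul_hat (B : Matrix (Index c n) (Index c n) K)
    (W : Matrix (Index c n) (Index c n) R) :
    twist (W * hat R B) = hat R (twist B) * twist W := by
  rw [twist_mul (fun i j k l => (commute_hat B W k l i j).symm), twist_hat]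

end HatTwist

/-! ### Equivariant matrices over U(g). -/

section Equivariant

variable {K : Type*} [Field K] {c : ClassicalFamily} {n : ℕ}

/-- The universal enveloping algebra of the classical Lie algebra. -/
abbrev Env (K : Type*) [Field K] (c : ClassicalFamily) (n : ℕ) : Type _ :=
  UniversalEnvelopingAlgebra K (liealg K c n)

/-- Square matrices over the universal enveloping algebra. -/
abbrev EnvMatrix (K : Type*) [Field K] (c : ClassicalFamily) (n : ℕ) : Type _ :=
  Matrix (Index c n) (Index c n) (Env K c n)

theorem genCarrier_eq_sub_twist (i j : Index c n) :
    genCarrier K i j = Matrix.single i j 1 - twist (Matrix.single i j 1) := by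
  rw [twist_single, genCarrier, Int.cast_smul_eq_zsmul]

theorem coe_linearElt (B : Matrix (Index c n) (Index c n) K) :
    (linearElt B : Matrix (Index c n) (Index c n) K) = Bᵀ - twist Bᵀ := by
  have hc : (linearElt B : Matrix (Index c n) (Index c n) K) =
      ∑ i, ∑ j, B j i • genCarrier K i j := by
    rw [linearElt, ← LieSubalgebra.coe_incl', map_sum]
    simp only [map_sum, map_smul]
    rfl
  have h1 : ∀ p q, (∑ i, ∑ j, B j i * (Matrix.single i j (1 : K) p q)) = B q p := by
    intro p q
    simp [Matrix.single_apply, ite_and]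
  rw [hc]
  ext p q
  simp only [Matrix.sum_apply, Matrix.smul_apply, genCarrier_eq_sub_twist, Matrix.sub_apply,
    smul_eq_mul, mul_sub, Finset.sum_sub_distrib, h1, twist_apply, mul_smul_comm,
    ← Finset.smul_sum, transpose_apply]

theorem ι_linearElt (B : Matrix (Index c n) (Index c n) K) :
    UniversalEnvelopingAlgebra.ι K (linearElt B) =
      trace (hat (Env K c n) B * genMatrix K c n) := by
  simp only [linearElt, map_sum, map_smul, trace, diag_apply, mul_apply, hat_apply, genMatrix,
    of_apply, Algebra.smul_def]
  exact Finset.sum_comm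

theorem gen_eq_linearElt (i j : Index c n) : gen K i j = linearElt (Matrix.single j i 1) := by
  apply Subtype.ext
  rw [coe_linearElt, transpose_single]
  exact genCarrier_eq_sub_twist i j

theorem twist_genMatrix : twist (genMatrix K c n) = -genMatrix K c n := by
  ext i j
  rw [Matrix.neg_apply]
  simp only [twist_apply, genMatrix, of_apply]
  rw [gen_symm K i j, neg_smul, map_neg, neg_neg, Int.cast_smul_eq_zsmul, map_zsmul]

theorem twist_coe (Y : liealg K c n) :
    twist (Y : Matrix (Index c n) (Index c n) K) = -(Y : Matrix (Index c n) (Index c n) K) := by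
  ext i j
  have h := Y.2 i j
  rw [Matrix.neg_apply, twist_apply, h, ← Int.cast_smul_eq_zsmul K, smul_eq_mul]
  ring

theorem twist_transpose {R : Type*} [Ring R] (Y : Matrix (Index c n) (Index c n) R) :
    twist Yᵀ = (twist Y)ᵀ := by
  ext i j
  simp only [twist_apply, transpose_apply, mul_comm (eps c i)]

/-- A matrix over `U(g)` whose entries transform under `g` like those of `X`. -/
def IsEquivariant (W : EnvMatrix K c n) : Prop :=
  ∀ Y : liealg K c n,
    Matrix.scalar _ (UniversalEnvelopingAlgebra.ι K Y) * W -
      W * Matrix.scalar _ (UniversalEnvelopingAlgebra.ι K Y) =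
    hat _ (Y : Matrix (Index c n) (Index c n) K)ᵀ * W -
      W * hat _ (Y : Matrix (Index c n) (Index c n) K)ᵀ

theorem scalar_mul_sub_apply {ι R : Type*} [Fintype ι] [DecidableEq ι] [Ring R] (u : R)
    (W : Matrix ι ι R) (i j : ι) :
    (Matrix.scalar ι u * W - W * Matrix.scalar ι u) i j = u * W i j - W i j * u := by
  simp

/-- Since X_{k,l} = (E_{l,k}X), its bracket with Y is (CX) with C = [E_{l,k}, Yᵀ]. The transposes
come from the convention (BX) = ∑ B_{j,i} X_{i,j}. -/
theorem isEquivariant_genMatrix : IsEquivariant (genMatrix K c n) := by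
  intro Y
  ext k l
  have h : ⁅Y, gen K k l⁆ = linearElt (Matrix.single l k 1 * (Y : Matrix _ _ K)ᵀ -
      (Y : Matrix _ _ K)ᵀ * Matrix.single l k 1) := by
    apply Subtype.ext
    rw [coe_linearElt, LieSubalgebra.coe_bracket, Ring.lie_def]
    change (Y : Matrix _ _ K) * genCarrier K k l - genCarrier K k l * (Y : Matrix _ _ K) = _
    rw [transpose_sub, transpose_mul, transpose_mul, transpose_transpose, transpose_single,
      twist_sub, twist_mul (fun _ _ _ _ => Commute.all _ _),
      twist_mul (fun _ _ _ _ => Commute.all _ _), twist_coe, genCarrier_eq_sub_twist]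
    noncomm_ring
  have e : UniversalEnvelopingAlgebra.ι K ⁅Y, gen K k l⁆ =
      UniversalEnvelopingAlgebra.ι K Y * UniversalEnvelopingAlgebra.ι K (gen K k l) -
        UniversalEnvelopingAlgebra.ι K (gen K k l) * UniversalEnvelopingAlgebra.ι K Y := by
    rw [LieHom.map_lie, Ring.lie_def]
  rw [scalar_mul_sub_apply]
  change UniversalEnvelopingAlgebra.ι K Y * UniversalEnvelopingAlgebra.ι K (gen K k l) -
    UniversalEnvelopingAlgebra.ι K (gen K k l) * UniversalEnvelopingAlgebra.ι K Y = _
  rw [← e, h, ι_linearElt, map_sub, map_mul, map_mul, sub_mul, trace_sub, mul_assoc, mul_assoc,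
    trace_hat_single_mul, trace_hat_mul_comm, mul_assoc, trace_hat_single_mul, Matrix.sub_apply]

theorem isEquivariant_one : IsEquivariant (1 : EnvMatrix K c n) := fun Y => by simp

theorem IsEquivariant.mul {V W : EnvMatrix K c n} (hV : IsEquivariant V) (hW : IsEquivariant W) :
    IsEquivariant (V * W) := fun Y => by
  have h : ∀ S : EnvMatrix K c n,
      S * (V * W) - V * W * S = (S * V - V * S) * W + V * (S * W - W * S) := fun S => by
    noncomm_ring
  rw [h, h, hV Y, hW Y]

theorem IsEquivariant.pow {W : EnvMatrix K c n} (hW : IsEquivariant W) (M : ℕ) :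
    IsEquivariant (W ^ M) := by
  induction M with
  | zero => simpa using isEquivariant_one
  | succ M ih => rw [pow_succ]; exact ih.mul hW

theorem isEquivariant_genMatrix_pow (M : ℕ) : IsEquivariant (genMatrix K c n ^ M) :=
  isEquivariant_genMatrix.pow M

theorem IsEquivariant.add {V W : EnvMatrix K c n} (hV : IsEquivariant V) (hW : IsEquivariant W) :
    IsEquivariant (V + W) := fun Y => by
  rw [mul_add, add_mul, add_sub_add_comm, hV Y, hW Y]
  noncomm_ring

theorem IsEquivariant.smul {W : EnvMatrix K c n} (a : K) (hW : IsEquivariant W) :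
    IsEquivariant (a • W) := fun Y => by
  rw [mul_smul_comm, smul_mul_assoc, ← smul_sub, hW Y, mul_smul_comm, smul_mul_assoc, smul_sub]

theorem commute_scalar_of_central {z : Env K c n} (hz : ∀ u, Commute z u) (W : EnvMatrix K c n) :
    Commute (Matrix.scalar _ z) W :=
  Matrix.scalar_commute _ hz _

theorem isEquivariant_scalar {z : Env K c n} (hz : ∀ u, Commute z u) :
    IsEquivariant (Matrix.scalar (Index c n) z) := fun Y => by
  rw [(commute_scalar_of_central hz _).eq, (commute_scalar_of_central hz _).eq, sub_self, sub_self]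

/-- The action of `g` on `(BW)` for an equivariant `W`. -/
theorem IsEquivariant.ι_mul_trace_sub {W : EnvMatrix K c n} (hW : IsEquivariant W)
    (Y : liealg K c n) (B : Matrix (Index c n) (Index c n) K) :
    UniversalEnvelopingAlgebra.ι K Y * trace (hat _ B * W) -
      trace (hat _ B * W) * UniversalEnvelopingAlgebra.ι K Y =
    trace (hat _ (B * (Y : Matrix _ _ K)ᵀ - (Y : Matrix _ _ K)ᵀ * B) * W) := by
  have h1 : UniversalEnvelopingAlgebra.ι K Y * trace (hat _ B * W) -
      trace (hat _ B * W) * UniversalEnvelopingAlgebra.ι K Y =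
      trace (hat _ B * (Matrix.scalar _ (UniversalEnvelopingAlgebra.ι K Y) * W -
        W * Matrix.scalar _ (UniversalEnvelopingAlgebra.ι K Y))) := by
    simp only [trace, diag_apply, mul_apply (M := hat _ B), scalar_mul_sub_apply]
    simp only [Finset.mul_sum, Finset.sum_mul, ← Finset.sum_sub_distrib, hat_apply, mul_sub]
    refine Finset.sum_congr rfl fun i _ => Finset.sum_congr rfl fun j _ => ?_
    simp only [← Algebra.smul_def, mul_smul_comm, smul_mul_assoc]
  rw [h1, hW Y, mul_sub, trace_sub, map_sub, map_mul, map_mul, sub_mul, trace_sub, mul_assoc,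
    mul_assoc, ← mul_assoc (hat _ B) W, ← trace_hat_mul_comm]

/-- The elements satisfying `p` form a subalgebra S containing g. By the universal property the
identity of U(g) factors through S. -/
theorem induction_env {p : Env K c n → Prop} (hι : ∀ Y, p (UniversalEnvelopingAlgebra.ι K Y))
    (halg : ∀ a, p (algebraMap K _ a)) (hmul : ∀ u v, p u → p v → p (u * v))
    (hadd : ∀ u v, p u → p v → p (u + v)) (u : Env K c n) : p u := by
  let S : Subalgebra K (Env K c n) :=
    { carrier := {u | p u}
      mul_mem' := fun {u v} => hmul u v
      add_mem' := fun {u v} => hadd u v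
      algebraMap_mem' := halg }
  let φ : liealg K c n →ₗ⁅K⁆ S :=
    { toFun := fun Y => ⟨UniversalEnvelopingAlgebra.ι K Y, hι Y⟩
      map_add' := fun Y Z => Subtype.ext (by simp)
      map_smul' := fun a Y => Subtype.ext (by simp)
      map_lie' := fun {Y Z} => Subtype.ext (by simp [LieHom.map_lie, Ring.lie_def]) }
  have h : S.val.comp (UniversalEnvelopingAlgebra.lift K φ) = AlgHom.id K _ := by
    apply UniversalEnvelopingAlgebra.hom_ext
    ext Y
    simp [φ]
  have h' := congrArg (fun f => f u) h
  simp only [AlgHom.comp_apply, AlgHom.id_apply] at h'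
  rw [← h']
  exact (UniversalEnvelopingAlgebra.lift K φ u).2

/-- The action on (BW) replaces B by [B, Yᵀ], which is zero for B = 1; g generates U(g). -/
theorem IsEquivariant.trace_central {W : EnvMatrix K c n} (hW : IsEquivariant W) (u : Env K c n) :
    Commute (trace W) u := by
  refine induction_env (p := fun u => Commute (trace W) u) (fun Y => ?_)
    (fun a => (Algebra.commutes a _).symm) (fun u v => Commute.mul_right)
    (fun u v => Commute.add_right) u
  have h := hW.ι_mul_trace_sub Y 1
  simp only [map_one, one_mul, mul_one, sub_self, map_zero, zero_mul, trace_zero] at h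
  exact (sub_eq_zero.1 h).symm

/-- The commutators of the entries of `X` with `(BW)` for an equivariant `W`. -/
theorem IsEquivariant.genMatrix_mul_sub {W : EnvMatrix K c n} (hW : IsEquivariant W)
    (B : Matrix (Index c n) (Index c n) K) :
    genMatrix K c n * Matrix.scalar _ (trace (hat _ B * W)) -
      Matrix.scalar _ (trace (hat _ B * W)) * genMatrix K c n =
    (W * hat _ B - hat _ B * W) - twist (W * hat _ B - hat _ B * W) := by
  ext i j
  rw [← neg_sub, Matrix.neg_apply, scalar_mul_sub_apply, neg_sub]
  change UniversalEnvelopingAlgebra.ι K (gen K i j) * trace (hat _ B * W) -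
    trace (hat _ B * W) * UniversalEnvelopingAlgebra.ι K (gen K i j) = _
  have hg : ((gen K i j : Matrix (Index c n) (Index c n) K))ᵀ =
      Matrix.single j i 1 - twist (Matrix.single j i 1) := by
    rw [gen_eq_linearElt, coe_linearElt, twist_transpose, ← transpose_sub, transpose_transpose]
  rw [hW.ι_mul_trace_sub, hg, map_sub, map_mul, map_mul, sub_mul, mul_assoc, trace_sub,
    trace_hat_mul_comm, mul_assoc, mul_assoc, ← trace_sub, ← mul_sub, map_sub, ← twist_hat,
    sub_mul, trace_sub, ← trace_mul_twist, trace_hat_single_mul, trace_hat_single_mul,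
    Matrix.sub_apply _ (twist _)]

end Equivariant

/-! ### Reordering rules and the Leibniz expansion. -/

section Commutators

variable {K : Type*} [Field K] {c : ClassicalFamily} {n : ℕ}

/-- The transpose of `X W` for an equivariant matrix `W`. -/
theorem IsEquivariant.twist_genMatrix_mul {W : EnvMatrix K c n} (hW : IsEquivariant W) :
    twist (genMatrix K c n * W) = -(twist W * genMatrix K c n) +
      ((Fintype.card (Index c n) : ℤ) - negSign c) • twist W + negSign c • W -
        Matrix.scalar _ (trace W) := by
  have hk : ∀ i j k : Index c n, genMatrix K c n (-j) k * W k (-i) =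
      W k (-i) * genMatrix K c n (-j) k + (W (-j) (-i) - if -i = -j then W k k else 0) -
        (eps c (-j) * eps c k) • ((if k = j then W (-k) (-i) else 0) -
          if i = k then W k j else 0) := by
    intro i j k
    -- The entry W_{k,-i} is (E_{-i,k}W), so the general commutator formula gives its commutator
    -- with an entry of X.
    have h := congrFun (congrFun (hW.genMatrix_mul_sub (Matrix.single (-i) k 1)) (-j)) k
    rw [← neg_sub, Matrix.neg_apply, scalar_mul_sub_apply, trace_hat_single_mul] at h
    simp only [Matrix.sub_apply, twist_apply, hat_single_mul_apply, mul_hat_single_apply,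
      neg_neg_index, if_true] at h
    rw [neg_sub, sub_eq_iff_eq_add] at h
    simp only [(Function.Involutive.injective neg_neg_index).eq_iff (a := i)] at h ⊢
    rw [h]
    abel
  have hs : ∀ i j : Index c n, eps c i * eps c j * (eps c (-j) * eps c i) = negSign c := by
    intro i j
    rw [eps_neg]
    linear_combination negSign c * eps c j * eps c j * eps_mul_self i +
      negSign c * eps_mul_self j
  have hs' : ∀ j : Index c n, eps c (-j) * eps c j = negSign c := by
    intro j
    rw [eps_neg]
    linear_combination negSign c * eps_mul_self j
  ext i j
  -- Antisymmetry of X puts the reordered sum into the shape of a matrix product with `twist W` on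
  -- the left.
  have hX : ∀ k, W k (-i) * genMatrix K c n (-j) k =
      -((eps c (-j) * eps c k) • (W k (-i) * genMatrix K c n (-k) j)) := by
    intro k
    have h := congrFun (congrFun (twist_genMatrix (K := K) (c := c) (n := n)) (-j)) k
    rw [twist_apply, Matrix.neg_apply, neg_neg_index] at h
    rw [← neg_eq_iff_eq_neg.2 h, mul_neg, mul_smul_comm]
  have h1 : (eps c i * eps c j) • ∑ k, W k (-i) * genMatrix K c n (-j) k =
      -(twist W * genMatrix K c n) i j := by
    rw [mul_apply, ← sum_neg_index, Finset.smul_sum, ← Finset.sum_neg_distrib]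
    refine Finset.sum_congr rfl fun k _ => ?_
    rw [hX, twist_apply, neg_neg_index, smul_neg, smul_mul_assoc, smul_smul, eps_neg, eps_neg]
    congr 2
    linear_combination negSign c * negSign c * eps c i * eps c k * eps_mul_self j +
      eps c i * eps c k * negSign_mul_self c
  have h2 : ∑ k, (eps c (-j) * eps c k) • ((if k = j then W (-k) (-i) else 0) -
        if i = k then W k j else 0) =
      negSign c • W (-j) (-i) - (eps c (-j) * eps c i) • W i j := by
    simp only [smul_sub, smul_ite, smul_zero, Finset.sum_sub_distrib, Finset.sum_ite_eq,
      Finset.sum_ite_eq', Finset.mem_univ, if_true, hs']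
  have h3 : (eps c i * eps c j) • (∑ k, if -i = -j then W k k else 0) =
      (Matrix.scalar (Index c n) (trace W)) i j := by
    rw [scalar_apply]
    by_cases h : i = j
    · subst h
      simp [eps_mul_self, trace]
    · simp [h, (Function.Involutive.injective neg_neg_index).eq_iff (a := i)]
  rw [twist_apply, mul_apply, Finset.sum_congr rfl fun k _ => hk i j k,
    Finset.sum_sub_distrib, Finset.sum_add_distrib, Finset.sum_sub_distrib]
  rw [h2, smul_sub, smul_add, h1, smul_sub, h3, smul_sub, smul_smul (_ * _) (_ * _), hs,
    Finset.sum_const, Finset.card_univ, Matrix.sub_apply, Matrix.add_apply, Matrix.add_apply,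
    Matrix.neg_apply, Matrix.smul_apply, Matrix.smul_apply, twist_apply, sub_smul,
    ← natCast_zsmul, smul_comm _ (Fintype.card _ : ℤ), smul_comm _ (negSign c)]
  abel

theorem pow_succ_mul_sub {R : Type*} [Ring R] (x w : R) (a : ℕ) :
    x ^ (a + 1) * w - w * x ^ (a + 1) =
      ∑ p ∈ antidiagonal a, x ^ p.1 * (x * w - w * x) * x ^ p.2 := by
  induction a with
  | zero => simp
  | succ a ih =>
    have h : x ^ (a + 1 + 1) * w - w * x ^ (a + 1 + 1) =
        (x * w - w * x) * x ^ (a + 1) + x * (x ^ (a + 1) * w - w * x ^ (a + 1)) := by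
      rw [pow_succ' x (a + 1)]
      noncomm_ring
    rw [h, ih, Finset.mul_sum, Finset.Nat.sum_antidiagonal_succ]
    simp only [pow_zero, one_mul, pow_succ' x (Prod.fst _), mul_assoc]

/-- The two sums of a Leibniz expansion match only after the exponents r and s are exchanged. -/
theorem sum_antidiagonal_eq_of_swap {M : Type*} [AddCommMonoid M] {a : ℕ} {f g : ℕ → ℕ → M}
    (h : ∀ r s, r + s = a → f r s = g s r) :
    ∑ p ∈ antidiagonal a, f p.1 p.2 =
      ∑ p ∈ antidiagonal a, g p.1 p.2 := by
  rw [← Finset.Nat.sum_antidiagonal_swap]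
  exact Finset.sum_congr rfl fun p hp => h _ _ (by
    have := Finset.HasAntidiagonal.mem_antidiagonal.1 hp
    simp only [Prod.fst_swap, Prod.snd_swap]
    omega)

/-! ### The degree filtration by powers of X with central coefficients. -/

/-- The span of the `z X^i` with `z` central and `i ≤ a`. -/
noncomputable def centralSpan (K : Type*) [Field K] (c : ClassicalFamily) (n a : ℕ) :
    Submodule K (EnvMatrix K c n) :=
  Submodule.span K {W | ∃ z : Env K c n, (∀ u, Commute z u) ∧ ∃ i ≤ a,
    W = Matrix.scalar _ z * genMatrix K c n ^ i}

theorem scalar_mul_pow_mem_centralSpan {z : Env K c n} (hz : ∀ u, Commute z u) {i a : ℕ}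
    (h : i ≤ a) : Matrix.scalar _ z * genMatrix K c n ^ i ∈ centralSpan K c n a :=
  Submodule.subset_span ⟨z, hz, i, h, rfl⟩

theorem pow_mem_centralSpan {i a : ℕ} (h : i ≤ a) :
    genMatrix K c n ^ i ∈ centralSpan K c n a := by
  simpa using scalar_mul_pow_mem_centralSpan (z := (1 : Env K c n)) (fun u => Commute.one_left u) h

theorem centralSpan_mono {a b : ℕ} (h : a ≤ b) : centralSpan K c n a ≤ centralSpan K c n b :=
  Submodule.span_mono fun _ ⟨z, hz, i, hi, e⟩ => ⟨z, hz, i, hi.trans h, e⟩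

theorem isEquivariant_of_mem_centralSpan {a : ℕ} {W : EnvMatrix K c n}
    (hW : W ∈ centralSpan K c n a) : IsEquivariant W := by
  induction hW using Submodule.span_induction with
  | mem W h =>
    obtain ⟨z, hz, i, -, rfl⟩ := h
    exact (isEquivariant_scalar hz).mul (isEquivariant_genMatrix_pow i)
  | zero => exact fun Y => by simp
  | add V W _ _ hV hW => exact hV.add hW
  | smul k W _ hW => exact hW.smul k

theorem commute_pow_of_mem_centralSpan {a : ℕ} {W : EnvMatrix K c n}
    (hW : W ∈ centralSpan K c n a) (r : ℕ) : Commute (genMatrix K c n ^ r) W := by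
  induction hW using Submodule.span_induction with
  | mem W h =>
    obtain ⟨z, hz, i, -, rfl⟩ := h
    exact ((commute_scalar_of_central hz _).symm).mul_right (Commute.pow_pow_self _ _ _)
  | zero => exact Commute.zero_right _
  | add V W _ _ hV hW => exact hV.add_right hW
  | smul k W _ hW => exact hW.smul_right k

theorem mul_pow_mem_centralSpan {a : ℕ} {W : EnvMatrix K c n}
    (hW : W ∈ centralSpan K c n a) {r b : ℕ} (h : a + r ≤ b) :
    W * genMatrix K c n ^ r ∈ centralSpan K c n b := by
  induction hW using Submodule.span_induction with
  | mem W h =>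
    obtain ⟨z, hz, i, hi, rfl⟩ := h
    rw [mul_assoc, ← pow_add]
    exact scalar_mul_pow_mem_centralSpan hz (by omega)
  | zero => rw [zero_mul]; exact Submodule.zero_mem _
  | add V W _ _ hV hW => rw [add_mul]; exact Submodule.add_mem _ hV hW
  | smul k W _ hW => rw [smul_mul_assoc]; exact Submodule.smul_mem _ _ hW

theorem scalar_mul_mem_centralSpan {z : Env K c n} (hz : ∀ u, Commute z u) {a : ℕ}
    {W : EnvMatrix K c n} (hW : W ∈ centralSpan K c n a) :
    Matrix.scalar _ z * W ∈ centralSpan K c n a := by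
  induction hW using Submodule.span_induction with
  | mem W h =>
    obtain ⟨y, hy, i, hi, rfl⟩ := h
    rw [← mul_assoc, ← map_mul]
    exact scalar_mul_pow_mem_centralSpan (fun u => (hz u).mul_left (hy u)) hi
  | zero => rw [mul_zero]; exact Submodule.zero_mem _
  | add V W _ _ hV hW => rw [mul_add]; exact Submodule.add_mem _ hV hW
  | smul k W _ hW => rw [mul_smul_comm]; exact Submodule.smul_mem _ _ hW

theorem twist_scalar_mul (z : Env K c n) (W : EnvMatrix K c n) :
    twist (Matrix.scalar _ z * W) = Matrix.scalar _ z * twist W := by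
  have h : ∀ (V : EnvMatrix K c n) i j, (Matrix.scalar (Index c n) z * V) i j = z * V i j := by simp
  ext i j
  rw [twist_apply, h, h, twist_apply, mul_smul_comm]

/-- In the formula for `twist (X * X ^ i)` only the first term raises the degree, by one, and the
trace term is a central multiple of X⁰. -/
theorem twist_pow_mem_centralSpan (i : ℕ) :
    twist (genMatrix K c n ^ i) ∈ centralSpan K c n i := by
  induction i with
  | zero =>
    rw [pow_zero, twist_one, ← pow_zero (genMatrix K c n)]
    exact pow_mem_centralSpan le_rfl
  | succ i ih =>
    rw [pow_succ', (isEquivariant_genMatrix_pow i).twist_genMatrix_mul]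
    have ih' := centralSpan_mono (Nat.le_succ i) ih
    have h1 : genMatrix K c n ^ i ∈ centralSpan K c n (i + 1) := pow_mem_centralSpan (Nat.le_succ i)
    have h2 := scalar_mul_pow_mem_centralSpan (K := K)
      (isEquivariant_genMatrix_pow (c := c) (n := n) i).trace_central (Nat.zero_le (i + 1))
    rw [pow_zero, mul_one] at h2
    have h3 := mul_pow_mem_centralSpan ih (le_refl (i + 1))
    rw [pow_one] at h3
    exact Submodule.sub_mem _ (Submodule.add_mem _ (Submodule.add_mem _ (Submodule.neg_mem _ h3)
      (zsmul_mem ih' _)) (zsmul_mem h1 _)) h2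

theorem twist_mem_centralSpan {a : ℕ} {W : EnvMatrix K c n} (hW : W ∈ centralSpan K c n a) :
    twist W ∈ centralSpan K c n a := by
  induction hW using Submodule.span_induction with
  | mem W h =>
    obtain ⟨z, hz, i, hi, rfl⟩ := h
    rw [twist_scalar_mul]
    exact scalar_mul_mem_centralSpan hz (centralSpan_mono hi (twist_pow_mem_centralSpan i))
  | zero =>
    have h : twist (0 : EnvMatrix K c n) = 0 := by ext; simp [twist_apply]
    rw [h]
    exact Submodule.zero_mem _
  | add V W _ _ hV hW => rw [twist_add]; exact Submodule.add_mem _ hV hW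
  | smul k W _ hW => rw [twist_smul]; exact Submodule.smul_mem _ _ hW

/-! ### The pairing and the simultaneous induction. -/

/-- The element `∑ A_{i,j} Y_{j,k} A_{k,l} Z_{l,i}`. -/
noncomputable def pairing (A : Matrix (Index c n) (Index c n) K) (Y Z : EnvMatrix K c n) :
    Env K c n :=
  trace (hat _ A * Y * hat _ A * Z)

theorem trace_scalar_mul {ι R : Type*} [Fintype ι] [DecidableEq ι] [Ring R] (u : R)
    (W : Matrix ι ι R) : trace (Matrix.scalar ι u * W) = u * trace W := by
  simp [trace, Finset.mul_sum]

theorem trace_mul_scalar {ι R : Type*} [Fintype ι] [DecidableEq ι] [Ring R] (u : R)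
    (W : Matrix ι ι R) : trace (W * Matrix.scalar ι u) = trace W * u := by
  simp [trace, Finset.sum_mul]

theorem commute_scalar_hat {ι R : Type*} [Fintype ι] [DecidableEq ι] [Ring R] [Algebra K R] (u : R)
    (B : Matrix ι ι K) : Commute (Matrix.scalar ι u) (hat R B) := by
  ext i j
  rw [← sub_eq_zero, ← Matrix.sub_apply, scalar_mul_sub_apply, hat_apply, Algebra.commutes,
    sub_self]

/-- The commutator is tr(A [X^{a+1}, (AW)]), expanded by the Leibniz rule. Each [X, (AW)] uses up
one factor X, so the total degree drops by one. -/
theorem trace_pow_mul_sub {A : Matrix (Index c n) (Index c n) K} {s : ℤ} (hA : twist A = s • A)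
    {W : EnvMatrix K c n} (hW : IsEquivariant W) (a : ℕ) :
    trace (hat _ A * genMatrix K c n ^ (a + 1)) * trace (hat _ A * W) -
      trace (hat _ A * W) * trace (hat _ A * genMatrix K c n ^ (a + 1)) =
    ∑ p ∈ antidiagonal a,
      pairing A (genMatrix K c n ^ p.1 * (W + s • twist W)) (genMatrix K c n ^ p.2) -
    ∑ p ∈ antidiagonal a,
      pairing A (genMatrix K c n ^ p.1) ((W + s • twist W) * genMatrix K c n ^ p.2) := by
  -- The eigenvector property of A merges the twisted half of [X, (AW)] with the untwisted half: W
  -- is simply replaced by W + s·`twist W`.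
  have h : W * hat _ A - hat _ A * W - twist (W * hat _ A - hat _ A * W) =
      (W + s • twist W) * hat _ A - hat _ A * (W + s • twist W) := by
    rw [twist_sub, twist_mul_hat, twist_hat_mul, hA, map_zsmul]
    simp only [smul_mul_assoc, mul_smul_comm, add_mul, mul_add]
    abel
  rw [← trace_mul_scalar, ← trace_scalar_mul, ← mul_assoc, (commute_scalar_hat _ _).eq, mul_assoc,
    mul_assoc, ← trace_sub, ← mul_sub, pow_succ_mul_sub, hW.genMatrix_mul_sub, h, Finset.mul_sum,
    trace_sum, ← Finset.sum_sub_distrib]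
  refine Finset.sum_congr rfl fun p _ => ?_
  rw [pairing, pairing, ← trace_sub]
  congr 1
  noncomm_ring

theorem sum_mul_hat_single_mul_apply {ι R : Type*} [Fintype ι] [DecidableEq ι] [Ring R]
    [Algebra K R] (F G : Matrix ι ι R) :
    ∑ i : ι, ∑ l : ι, (F * hat R (Matrix.single i l (1 : K)) * G) i l = trace F * trace G := by
  simp only [mul_apply (N := G), mul_hat_single_apply, ite_mul, zero_mul, Finset.sum_ite_eq,
    Finset.mem_univ, if_true, trace, diag_apply, Finset.sum_mul_sum]

theorem sum_mul_twist_hat_single_mul_apply (F G : EnvMatrix K c n) :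
    ∑ i : Index c n, ∑ l : Index c n,
      (F * twist (hat (Env K c n) (Matrix.single i l (1 : K))) * G) i l =
      negSign c • trace (F * twist G) := by
  have h : ∀ i l : Index c n, (F * twist (hat (Env K c n) (Matrix.single i l (1 : K))) * G) i l =
      negSign c • (F i (-l) * twist G (-l) i) := by
    intro i l
    rw [twist_hat, twist_single, map_zsmul, mul_smul_comm, smul_mul_assoc, Matrix.smul_apply,
      mul_apply (N := G)]
    simp only [mul_hat_single_apply, ite_mul, zero_mul, Finset.sum_ite_eq,
      Finset.mem_univ, if_true]
    rw [twist_apply, mul_smul_comm, smul_smul, neg_neg_index, eps_neg]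
    congr 1
    linear_combination (-eps c i * eps c l) * negSign_mul_self c
  simp only [h, ← Finset.smul_sum]
  congr 1
  simp only [trace, diag_apply, mul_apply]
  exact Finset.sum_congr rfl fun i _ => sum_neg_index (fun l => F i l * twist G l i)

/-- By cyclicity in the scalar matrix A, the difference is the sum over i, l of the commutators of
(A X^{a+1} A)_{i,l} with W_{l,i} = (E_{i,l}W). After the Leibniz expansion, summing over i, l turns
each inner E_{i,l} into a product of two traces, and each inner `twist` of E_{i,l} into σ times a
single trace, which is again a pairing. -/
theorem pairing_pow_sub {A : Matrix (Index c n) (Index c n) K} {s : ℤ} (hA : twist A = s • A)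
    {W : EnvMatrix K c n} (hW : IsEquivariant W) (a : ℕ) :
    pairing A (genMatrix K c n ^ (a + 1)) W - pairing A W (genMatrix K c n ^ (a + 1)) =
    (∑ p ∈ antidiagonal a, trace (hat _ A * (genMatrix K c n ^ p.1 * W)) *
        trace (hat _ A * genMatrix K c n ^ p.2) -
      ∑ p ∈ antidiagonal a, trace (hat _ A * genMatrix K c n ^ p.1) *
        trace (hat _ A * (W * genMatrix K c n ^ p.2))) +
    (negSign c * s) •
      (∑ p ∈ antidiagonal a,
        pairing A (genMatrix K c n ^ p.1 * twist W) (twist (genMatrix K c n ^ p.2)) -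
      ∑ p ∈ antidiagonal a,
        pairing A (twist (genMatrix K c n ^ p.1)) (twist W * genMatrix K c n ^ p.2)) := by
  set X := genMatrix K c n
  set H := hat (Env K c n) A with hH
  have h0 : pairing A (X ^ (a + 1)) W - pairing A W (X ^ (a + 1)) =
      ∑ i : Index c n, ∑ l : Index c n, (H * (X ^ (a + 1) * Matrix.scalar (Index c n) (W l i) -
        Matrix.scalar (Index c n) (W l i) * X ^ (a + 1)) * H) i l := by
    have e1 : pairing A W (X ^ (a + 1)) = trace (W * (H * X ^ (a + 1) * H)) := by
      rw [pairing, mul_assoc, mul_assoc, ← hH, hH, trace_hat_mul_comm]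
      simp only [mul_assoc]
    have e2 : ∀ i l : Index c n, (H * (X ^ (a + 1) * Matrix.scalar (Index c n) (W l i) -
        Matrix.scalar (Index c n) (W l i) * X ^ (a + 1)) * H) i l =
        (H * X ^ (a + 1) * H) i l * W l i -
          W l i * (H * X ^ (a + 1) * H) i l := by
      intro i l
      have hc : Commute (Matrix.scalar (Index c n) (W l i)) H := commute_scalar_hat _ A
      rw [← neg_sub (W l i * _), ← scalar_mul_sub_apply, ← Matrix.neg_apply, neg_sub]
      rw [mul_assoc (_ * _) (H), ← hc.eq, ← mul_assoc, ← mul_assoc,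
        ← mul_assoc (scalar _ _) (H), hc.eq]
      noncomm_ring
    rw [e1, pairing]
    simp only [e2, Finset.sum_sub_distrib]
    refine congrArg₂ (· - ·) rfl ?_
    rw [Finset.sum_comm]
    rfl
  have h1 : ∀ i l : Index c n, H * (X ^ (a + 1) * Matrix.scalar (Index c n) (W l i) -
        Matrix.scalar (Index c n) (W l i) * X ^ (a + 1)) * H =
      ∑ p ∈ antidiagonal a,
        ((H * (X ^ p.1 * W)) * hat (Env K c n) (Matrix.single i l (1 : K)) * (X ^ p.2 * H) -
        (H * X ^ p.1) * hat (Env K c n) (Matrix.single i l (1 : K)) * (W * X ^ p.2 * H) +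
        ((H * (X ^ p.1 * twist W)) * twist (hat (Env K c n) (Matrix.single i l (1 : K))) *
          (X ^ p.2 * H) -
        (H * X ^ p.1) * twist (hat (Env K c n) (Matrix.single i l (1 : K))) *
          (twist W * X ^ p.2 * H))) := by
    intro i l
    rw [← trace_hat_single_mul (K := K) i l W, pow_succ_mul_sub, hW.genMatrix_mul_sub,
      twist_sub, twist_mul_hat, twist_hat_mul, ← twist_hat, Finset.mul_sum, Finset.sum_mul]
    refine Finset.sum_congr rfl fun p _ => ?_
    noncomm_ring
  rw [h0]
  simp only [h1, Matrix.sum_apply, Finset.sum_comm (s := Finset.univ (α := Index c n))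
    (t := antidiagonal a)]
  rw [← Finset.sum_sub_distrib, ← Finset.sum_sub_distrib, Finset.smul_sum,
    ← Finset.sum_add_distrib]
  refine Finset.sum_congr rfl fun p _ => ?_
  simp only [Matrix.add_apply, Matrix.sub_apply, Finset.sum_add_distrib, Finset.sum_sub_distrib,
    sum_mul_hat_single_mul_apply, sum_mul_twist_hat_single_mul_apply]
  -- Moving `twist` to the left factor avoids twisting the product of `twist W` and a power of X,
  -- whose entries need not commute.
  rw [trace_mul_twist (H * X ^ p.1), twist_hat_mul, twist_mul_hat, hA, map_zsmul,
    ← trace_hat_mul_comm, ← trace_hat_mul_comm, pairing, pairing, ← hH]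
  have e : trace (twist (X ^ p.1) * H * (twist W * X ^ p.2 * H)) =
      trace (H * twist (X ^ p.1) * H * (twist W * X ^ p.2)) := by
    rw [← mul_assoc _ (_ * _) H, hH, ← trace_hat_mul_comm]
    simp only [mul_assoc]
  simp only [smul_mul_assoc, mul_smul_comm, trace_smul, mul_smul, smul_sub, e,
    ← mul_assoc _ H]

theorem pairing_add_left (A : Matrix (Index c n) (Index c n) K) (Y Y' Z : EnvMatrix K c n) :
    pairing A (Y + Y') Z = pairing A Y Z + pairing A Y' Z := by
  simp only [pairing, mul_add, add_mul, trace_add]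

theorem pairing_add_right (A : Matrix (Index c n) (Index c n) K) (Y Z Z' : EnvMatrix K c n) :
    pairing A Y (Z + Z') = pairing A Y Z + pairing A Y Z' := by
  simp only [pairing, mul_add, trace_add]

theorem pairing_smul_left (A : Matrix (Index c n) (Index c n) K) (k : K) (Y Z : EnvMatrix K c n) :
    pairing A (k • Y) Z = k • pairing A Y Z := by
  simp only [pairing, mul_smul_comm, smul_mul_assoc, trace_smul]

theorem pairing_smul_right (A : Matrix (Index c n) (Index c n) K) (k : K) (Y Z : EnvMatrix K c n) :
    pairing A Y (k • Z) = k • pairing A Y Z := by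
  simp only [pairing, mul_smul_comm, trace_smul]

theorem pairing_scalar_mul_left (A : Matrix (Index c n) (Index c n) K) {z : Env K c n}
    (hz : ∀ u, Commute z u) (Y Z : EnvMatrix K c n) :
    pairing A (Matrix.scalar _ z * Y) Z = z * pairing A Y Z := by
  rw [pairing, ← mul_assoc, ← (commute_scalar_of_central hz (hat _ A)).eq, mul_assoc, mul_assoc,
    mul_assoc, trace_scalar_mul, pairing, mul_assoc, mul_assoc]

theorem pairing_scalar_mul_right (A : Matrix (Index c n) (Index c n) K) {z : Env K c n}
    (hz : ∀ u, Commute z u) (Y Z : EnvMatrix K c n) :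
    pairing A Y (Matrix.scalar _ z * Z) = z * pairing A Y Z := by
  rw [pairing, ← mul_assoc, ← (commute_scalar_of_central hz _).eq, mul_assoc, trace_scalar_mul,
    pairing]

/-- On the central span of the powers of `X`, the elements `(AY)` commute and the pairing is
symmetric. -/
theorem commute_trace_and_pairing_comm {A : Matrix (Index c n) (Index c n) K} {s : ℤ}
    (hA : twist A = s • A) (d : ℕ) : ∀ a b : ℕ, a + b = d → ∀ Y ∈ centralSpan K c n a,
      ∀ W ∈ centralSpan K c n b, Commute (trace (hat _ A * Y)) (trace (hat _ A * W)) ∧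
        pairing A Y W = pairing A W Y := by
  induction d using Nat.strong_induction_on with
  | _ d IH =>
  intro a b hd Y hY W hW
  induction hY using Submodule.span_induction with
  | zero => simp [pairing]
  | add Y Y' _ _ h h' =>
    rw [mul_add, trace_add, pairing_add_left, pairing_add_right, h.2, h'.2]
    exact ⟨h.1.add_left h'.1, rfl⟩
  | smul k Y _ h =>
    rw [mul_smul_comm, trace_smul, pairing_smul_left, pairing_smul_right, h.2]
    exact ⟨h.1.smul_left k, rfl⟩
  | mem Y h =>
    obtain ⟨z, hz, i, hi, rfl⟩ := h
    -- Central coefficients factor out, so Y may be taken to be a pure power of X, while W remains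
    -- arbitrary in its filtration step.
    rw [pairing_scalar_mul_left A hz, pairing_scalar_mul_right A hz, ← mul_assoc,
      ← (commute_scalar_of_central hz (hat _ A)).eq, mul_assoc, trace_scalar_mul]
    suffices h : Commute (trace (hat _ A * genMatrix K c n ^ i)) (trace (hat _ A * W)) ∧
        pairing A (genMatrix K c n ^ i) W = pairing A W (genMatrix K c n ^ i) from
      ⟨(hz _).mul_left h.1, by rw [h.2]⟩
    cases i with
    | zero =>
      have h1 : trace (hat (Env K c n) A) = algebraMap K _ (trace A) := by
        simp [trace]
      rw [pow_zero, mul_one, h1]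
      refine ⟨Algebra.commutes _ _, ?_⟩
      rw [pairing, pairing, mul_one, mul_one, mul_assoc, trace_hat_mul_comm]
    | succ i =>
      have hE := isEquivariant_of_mem_centralSpan hW
      have hT := twist_mem_centralSpan hW
      have hS : W + s • twist W ∈ centralSpan K c n b := Submodule.add_mem _ hW (zsmul_mem hT s)
      constructor
      · refine sub_eq_zero.1 ?_
        rw [trace_pow_mul_sub hA hE, sub_eq_zero]
        refine sum_antidiagonal_eq_of_swap
          (f := fun r t => pairing A (genMatrix K c n ^ r * (W + s • twist W)) (genMatrix K c n ^ t))
          (g := fun r t => pairing A (genMatrix K c n ^ r) ((W + s • twist W) * genMatrix K c n ^ t))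
          fun r t hrt => ?_
        rw [(commute_pow_of_mem_centralSpan hS r).eq]
        -- Here r + t = i and i + 1 ≤ a, so the total degree b + r + t is strictly less than d.
        exact (IH (b + r + t) (by omega) (b + r) t rfl _ (mul_pow_mem_centralSpan hS le_rfl) _
          (pow_mem_centralSpan le_rfl)).2
      · refine sub_eq_zero.1 ?_
        rw [pairing_pow_sub hA hE]
        -- The products of traces cancel by the commutativity half of the induction hypothesis, the
        -- twisted pairings by its symmetry half.
        rw [sum_antidiagonal_eq_of_swap
          (f := fun r t => trace (hat _ A * (genMatrix K c n ^ r * W)) *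
            trace (hat _ A * genMatrix K c n ^ t))
          (g := fun r t => trace (hat _ A * genMatrix K c n ^ r) *
            trace (hat _ A * (W * genMatrix K c n ^ t))),
          sum_antidiagonal_eq_of_swap
          (f := fun r t =>
            pairing A (genMatrix K c n ^ r * twist W) (twist (genMatrix K c n ^ t)))
          (g := fun r t =>
            pairing A (twist (genMatrix K c n ^ r)) (twist W * genMatrix K c n ^ t)),
          sub_self, sub_self, smul_zero, add_zero]
        · intro r t hrt
          rw [(commute_pow_of_mem_centralSpan hT r).eq]
          exact (IH (b + r + t) (by omega) (b + r) t rfl _ (mul_pow_mem_centralSpan hT le_rfl) _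
            (twist_pow_mem_centralSpan t)).2
        · intro r t hrt
          rw [(commute_pow_of_mem_centralSpan hW r).eq]
          exact (IH (b + r + t) (by omega) (b + r) t rfl _ (mul_pow_mem_centralSpan hW le_rfl) _
            (pow_mem_centralSpan le_rfl)).1

end Commutators

/-! ### Commutativity of F_A and its centralizer in g. -/

section Centralizer

variable {K : Type*} [Field K] {c : ClassicalFamily} {n : ℕ}

theorem shiftedPow_eq_trace (A : Matrix (Index c n) (Index c n) K) (M : ℕ) :
    shiftedPow A M = trace (hat _ A * genMatrix K c n ^ M) := by
  simp only [shiftedPow, trace, diag_apply, mul_apply, hat_apply, Algebra.smul_def]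
  exact Finset.sum_comm

theorem tracePow_central (M : ℕ) (u : Env K c n) : Commute (tracePow K c n M) u :=
  (isEquivariant_genMatrix_pow M).trace_central u

theorem commute_shiftedPow {A : Matrix (Index c n) (Index c n) K} {s : ℤ} (hA : twist A = s • A)
    (M L : ℕ) : Commute (shiftedPow A M) (shiftedPow A L) := by
  rw [shiftedPow_eq_trace, shiftedPow_eq_trace]
  exact (commute_trace_and_pairing_comm hA (M + L) M L rfl _ (pow_mem_centralSpan le_rfl) _
    (pow_mem_centralSpan le_rfl)).1

theorem commute_of_mem_FA {A : Matrix (Index c n) (Index c n) K} {s : ℤ} (hA : twist A = s • A)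
    {u v : Env K c n} (hu : u ∈ FA A) (hv : v ∈ FA A) : Commute u v := by
  refine Algebra.commute_of_mem_adjoin_of_forall_mem_commute hv fun y hy => ?_
  refine (Algebra.commute_of_mem_adjoin_of_forall_mem_commute hu fun x hx => ?_).symm
  rcases hy with ⟨L, -, rfl⟩ | ⟨L, -, rfl⟩
  · exact tracePow_central L x
  · rcases hx with ⟨M, -, rfl⟩ | ⟨M, -, rfl⟩
    · exact (tracePow_central M _).symm
    · exact commute_shiftedPow hA L M

theorem ι_mul_shiftedPow_sub (A : Matrix (Index c n) (Index c n) K) (Y : liealg K c n) (M : ℕ) :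
    UniversalEnvelopingAlgebra.ι K Y * shiftedPow A M -
      shiftedPow A M * UniversalEnvelopingAlgebra.ι K Y =
    shiftedPow (A * (Y : Matrix _ _ K)ᵀ - (Y : Matrix _ _ K)ᵀ * A) M := by
  rw [shiftedPow_eq_trace, shiftedPow_eq_trace]
  exact (isEquivariant_genMatrix_pow M).ι_mul_trace_sub Y A

theorem mem_centralizer_of_commute {A : Matrix (Index c n) (Index c n) K} {Y : liealg K c n}
    (h : Commute A (Y : Matrix _ _ K)ᵀ) : Y ∈ centralizer (FA A) := by
  intro f hf
  rw [Ring.lie_def, sub_eq_zero]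
  refine Algebra.commute_of_mem_adjoin_of_forall_mem_commute hf fun x hx => ?_
  rcases hx with ⟨L, -, rfl⟩ | ⟨L, -, rfl⟩
  · exact (tracePow_central L _).symm
  · refine sub_eq_zero.1 ?_
    rw [ι_mul_shiftedPow_sub, h.eq, sub_self, shiftedPow_eq_trace, map_zero, zero_mul, trace_zero]

/-- The transpose of the matrix of (BX) is B - `twist B`. Twisting the relation [B, A] = 0 shows
that `twist B` commutes with A as well, since `twist A` = ±A. -/
theorem gA_le_centralizer {A : Matrix (Index c n) (Index c n) K} {s : ℤ} (hs : s * s = 1)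
    (hA : twist A = s • A) : gA A ≤ (centralizer (FA A)).toSubmodule := by
  refine Submodule.span_le.2 ?_
  rintro _ ⟨B, hB, rfl⟩
  refine mem_centralizer_of_commute ?_
  rw [Ring.lie_def, sub_eq_zero] at hB
  rw [coe_linearElt, transpose_sub, transpose_transpose, ← twist_transpose, transpose_transpose]
  refine Commute.sub_right (Eq.symm hB) ?_
  have h := congrArg twist hB
  rw [twist_mul fun _ _ _ _ => Commute.all _ _, twist_mul fun _ _ _ _ => Commute.all _ _, hA,
    smul_mul_assoc, mul_smul_comm] at h
  have h' := congrArg (fun Z => s • Z) h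
  simp only [smul_smul, hs, one_smul] at h'
  exact h'

/-! ### Detecting B through the defining representation. -/

/-- The defining representation, extended to the universal enveloping algebra. -/
noncomputable def definingRep (K : Type*) [Field K] (c : ClassicalFamily) (n : ℕ) :
    Env K c n →ₐ[K] Matrix (Index c n) (Index c n) K :=
  UniversalEnvelopingAlgebra.lift K (liealg K c n).incl

theorem definingRep_ι (Y : liealg K c n) :
    definingRep K c n (UniversalEnvelopingAlgebra.ι K Y) = (Y : Matrix (Index c n) (Index c n) K) :=
  UniversalEnvelopingAlgebra.lift_ι_apply K _ _

theorem definingRep_shiftedPow_one (B : Matrix (Index c n) (Index c n) K) :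
    definingRep K c n (shiftedPow B 1) = Bᵀ - twist Bᵀ := by
  rw [shiftedPow_eq_trace, pow_one, ← ι_linearElt, definingRep_ι, coe_linearElt]

/-- Of the four products of matrix units, the first contributes N E_{i,j}, each mixed one -σ
E_{i,j}, and the last δ_{i,j} ∑ E_{-k,-k}, a multiple of the identity. -/
theorem sum_genCarrier_mul (i j : Index c n) :
    ∑ k, genCarrier K i k * genCarrier K k j =
      ((Fintype.card (Index c n) : ℤ) - 2 * negSign c) • Matrix.single i j (1 : K) +
        if i = j then 1 else 0 := by
  have hE : ∀ a b d e : Index c n,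
      (Matrix.single a b 1 * Matrix.single d e 1 : Matrix (Index c n) (Index c n) K) =
        if b = d then Matrix.single a e 1 else 0 := by
    intro a b d e
    split_ifs with h
    · subst h
      simp
    · exact Matrix.single_mul_single_of_ne _ _ _ _ h _
  have e1 : eps c i * eps c (-i) = negSign c := by
    rw [eps_neg]
    linear_combination negSign c * eps_mul_self i
  have e2 : eps c (-j) * eps c j = negSign c := by
    rw [eps_neg]
    linear_combination negSign c * eps_mul_self j
  have e3 : ∀ k : Index c n, (eps c k * eps c j) • (eps c i * eps c k) •
      (if -i = -j then Matrix.single (-k) (-k) (1 : K) else 0) =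
      if i = j then Matrix.single (-k) (-k) (1 : K) else 0 := by
    intro k
    simp only [(Function.Involutive.injective neg_neg_index).eq_iff (a := i)]
    split_ifs with h
    · subst h
      rw [smul_smul, mul_comm (eps c k), mul_mul_mul_comm, eps_mul_self, eps_mul_self, one_mul,
        one_smul]
    · simp
  have e4 : ∑ k : Index c n, Matrix.single (-k) (-k) (1 : K) = 1 := by
    rw [sum_neg_index (fun k : Index c n => Matrix.single k k (1 : K)), Matrix.sum_single_one]
  have e5 : ∀ k : Index c n, (eps c k * eps c j) •
      (if k = -j then Matrix.single i (-k) (1 : K) else 0) =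
      if k = -j then negSign c • Matrix.single i j (1 : K) else 0 := by
    intro k
    split_ifs with h
    · rw [h, neg_neg_index, e2]
    · rw [smul_zero]
  have e6 : ∀ k : Index c n, (eps c i * eps c k) •
      (if -i = k then Matrix.single (-k) j (1 : K) else 0) =
      if -i = k then negSign c • Matrix.single i j (1 : K) else 0 := by
    intro k
    split_ifs with h
    · rw [← h, neg_neg_index, e1]
    · rw [smul_zero]
  simp only [genCarrier, Int.cast_smul_eq_zsmul, sub_mul, mul_sub, smul_mul_assoc, mul_smul_comm,
    smul_sub, hE, e3, e5, e6, if_true, Finset.sum_sub_distrib, Finset.sum_ite_eq,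
    Finset.sum_ite_eq', Finset.mem_univ, Finset.sum_const, Finset.card_univ]
  have e7 : (∑ k : Index c n, if i = j then Matrix.single (-k) (-k) (1 : K) else 0) =
      if i = j then 1 else 0 := by
    split_ifs
    · exact e4
    · simp
  rw [e7, sub_smul, mul_smul, two_smul, natCast_zsmul]
  abel

theorem definingRep_shiftedPow_two (B : Matrix (Index c n) (Index c n) K) :
    definingRep K c n (shiftedPow B 2) =
      ((Fintype.card (Index c n) : ℤ) - 2 * negSign c) • Bᵀ + trace B • 1 := by
  have h : ∀ i j, definingRep K c n ((genMatrix K c n ^ 2) i j) =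
      ∑ k, genCarrier K i k * genCarrier K k j := by
    intro i j
    rw [pow_two, mul_apply, map_sum]
    refine Finset.sum_congr rfl fun k _ => ?_
    rw [map_mul]
    exact congrArg₂ (· * ·) (definingRep_ι _) (definingRep_ι _)
  rw [shiftedPow, map_sum]
  simp only [map_sum, map_smul, h, sum_genCarrier_mul, smul_add, Finset.sum_add_distrib]
  congr 1
  · ext p q
    simp only [Matrix.sum_apply, Matrix.smul_apply, Matrix.single_apply, transpose_apply,
      smul_comm (B _ _), ← Finset.smul_sum]
    simp [ite_and]
  · simp [trace, Finset.sum_smul]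

/-- The values are 2n - 1, 2n - 2 and 2n + 2 for the three families; only 2n - 2 can vanish, at n =
1. -/
theorem card_index_ne_two_mul_negSign (h : ¬ (c = soEven ∧ n = 1)) :
    (Fintype.card (Index c n) : ℤ) - 2 * negSign c ≠ 0 := by
  have hc : Fintype.card (Index c n) = (c.indexSet n).card := Fintype.card_coe _
  cases c
  · simp [hc, indexSet, negSign]
    omega
  · have hn : n ≠ 1 := fun e => h ⟨rfl, e⟩
    simp [hc, indexSet, negSign]
    omega
  · simp only [negSign]
    omega

theorem commute_of_mem_centralizer [CharZero K] {A : Matrix (Index c n) (Index c n) K} {s : ℤˣ}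
    (hA : twist A = (s : ℤ) • A) (hne : ¬ (c = soEven ∧ n = 1 ∧ s = 1)) {Y : liealg K c n}
    (hY : Y ∈ centralizer (FA A)) : Commute A (Y : Matrix _ _ K)ᵀ := by
  set B := A * (Y : Matrix _ _ K)ᵀ - (Y : Matrix _ _ K)ᵀ * A with hB
  suffices h : Bᵀ = 0 from sub_eq_zero.1 (by rw [← hB, ← transpose_transpose B, h, transpose_zero])
  have h0 : ∀ M, 1 ≤ M → shiftedPow B M = 0 := by
    intro M hM
    rw [hB, ← ι_mul_shiftedPow_sub, ← Ring.lie_def]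
    exact hY _ (Algebra.subset_adjoin (Or.inr ⟨M, hM, rfl⟩))
  -- The matrix B satisfies `twist B = s • B`. For `s = 1` this makes (BX) zero automatically, so
  -- degree two is needed; its identity term drops out because the commutator B has trace zero. For
  -- `s = -1` degree one already yields 2Bᵀ.
  rcases Int.units_eq_one_or s with rfl | rfl
  · have h := definingRep_shiftedPow_two B
    have ht : trace B = 0 := by rw [hB, trace_sub, trace_mul_comm, sub_self]
    rw [h0 2 one_le_two, map_zero, ht, zero_smul, add_zero, ← Int.cast_smul_eq_zsmul K] at h
    refine (smul_eq_zero.1 h.symm).resolve_left (Int.cast_ne_zero.2 ?_)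
    exact card_index_ne_two_mul_negSign fun e => hne ⟨e.1, e.2, rfl⟩
  · have h := definingRep_shiftedPow_one B
    have hT : twist B = -B := by
      rw [hB, twist_sub, twist_mul fun _ _ _ _ => Commute.all _ _,
        twist_mul fun _ _ _ _ => Commute.all _ _, hA, twist_transpose, twist_coe]
      simp
    rw [h0 1 le_rfl, map_zero, twist_transpose, hT, transpose_neg, sub_neg_eq_add, ← two_smul K] at h
    exact (smul_eq_zero.1 h.symm).resolve_left two_ne_zero

theorem mem_gA_of_commute [CharZero K] {A : Matrix (Index c n) (Index c n) K} {Y : liealg K c n}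
    (h : Commute A (Y : Matrix _ _ K)ᵀ) : Y ∈ gA A := by
  have h2 : (2 : K) • Y ∈ gA A := by
    -- The witness is B = Yᵀ, for which (BX) = ∑ Y_{i,j} X_{i,j} = 2Y.
    refine Submodule.subset_span ⟨(Y : Matrix (Index c n) (Index c n) K)ᵀ, ?_,
      two_smul_eq_sum_gen K Y⟩
    rw [Ring.lie_def, h.eq, sub_self]
  exact (Submodule.smul_mem_iff _ (two_ne_zero (α := K))).1 h2

end Centralizer

end ClassicalFamily

open ClassicalFamily in
theorem theorem2 {K : Type*} [Field K] [CharZero K] (c : ClassicalFamily) (n : ℕ) (s : ℤˣ)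
    (A : Matrix (Index c n) (Index c n) K)
    (hA : ∀ i j, A i j = (((s : ℤ) * eps c i * eps c j : ℤ) : K) * A (-j) (-i)) :
    (∀ u ∈ FA A, ∀ v ∈ FA A, u * v = v * u) ∧
      (¬ (c = soEven ∧ n = 1 ∧ s = 1) → (centralizer (FA A)).toSubmodule = gA A) := by
  have hs : (s : ℤ) * s = 1 := by
    rw [← Units.val_mul, Int.units_mul_self, Units.val_one]
  have hT : twist A = (s : ℤ) • A := by
    ext i j
    rw [Matrix.smul_apply, hA i j, twist_apply, ← Int.cast_smul_eq_zsmul K,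
      ← Int.cast_smul_eq_zsmul K, smul_eq_mul, smul_eq_mul, ← mul_assoc, ← Int.cast_mul,
      ← mul_assoc (s : ℤ), ← mul_assoc (s : ℤ), hs, one_mul]
  refine ⟨fun u hu v hv => commute_of_mem_FA hT hu hv, fun hne => le_antisymm (fun Y hY => ?_)
    (gA_le_centralizer hs hT)⟩
  exact mem_gA_of_commute (commute_of_mem_centralizer hT hne hY)
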